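/- **Conventions.** Let $G$ be a group and let $X\subseteq G$ generate $G$. The Cayley graph $\Gamma(G,X)$ has vertex set $G$ and edges $\{g,gx\}$ ($g\in G$, $x\in X$); its graph metric on $G$ is the word metric of $X$. For a set $\mathcal P$ of subgroups of $G$, let $G/\mathcal P$ be the set of all left cosets $gP$ with $g\in G$, $P\in\mathcal P$. - Let $G,H$ be finitely generated groups with word metrics of chosen finite generating sets, let $\mathcal P,\mathcal Q$ be finite sets of subgroups of $G$ and $H$, and let $\operatorname{Hdist}_H$ be the Hausdorff distance in $H$. A quasi-isometry $q\colon G\to H$ is a *quasi-isometry of pairs* $(G,\mathcal P)\to(H,\mathcal Q)$ if there is $M>0$ such that for every $A\in G/\mathcal P$ there is $B\in H/\mathcal Q$ with $\operatorname{Hdist}_H(q(A),B)<M$, and for every $B\in H/\mathcal Q$ there is $A\in G/\mathcal P$ with $\operatorname{Hdist}_H(q(A),B)<M$. - $\mathcal P$ is *reduced* if for all $P,Q\in\mathcal P$ and $g\in G$: if $P$ and $gQg^{-1}$ are commensurable (their intersection has finite index in both), then $P=Q$ and $g\in P$. - The commensurator of $P\le G$ is $\operatorname{Comm}_G(P)=\{g\in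 G : P \text{ and } gPg^{-1}\text{ are commensurable}\}$. A *refinement* $\mathcal P^*$ of $\mathcal P$ is a set containing exactly one representative of each conjugacy class of the collection $\{\operatorname{Comm}_G(gPg^{-1}) : P\in\mathcal P,\ g\in G\}$. - For an arbitrary subset $X\subseteq G$, $\mathcal P$ is *hyperbolically embedded in $G$ with respect to $X$*, written $\mathcal P\hookrightarrow_h(G,X)$, if (a) $G$ is generated by $X\cup\bigcup_{P\in\mathcal P}P$, and the Cayley graph $\Gamma(G,X\sqcup\mathcal H)$ is hyperbolic, where $\mathcal H=\bigsqcup_{P\in\mathcal P}P$ and edges are labelled by the disjoint union $X\sqcup\mathcal H$; and (b) for every $P\in\mathcal P$, all balls of finite radius in $(P,\widehat d_P)$ are finite, where $\widehat d_P(g,h)\in[0,\infty]$ is the length of a shortest path from $g$ to $h$ in $\Gamma(G,X\sqcup\mathcal H)$ containing no edge that joins two elements of $P$ and is labelled by a letter from the copy of $P$ in $\mathcal H$. **Theorem A.** Let $q\colon G\to H$ be a quasi-isometry of finitely generated groups, let $\mathcal P$ and $\mathcal Q$ be finite collections of subgroups of $G$ and $H$ respectively, and let $S$ and $T$ be (not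 necessarily finite) generating sets of $G$ and $H$ respectively. Suppose that $q\colon(G,\mathcal P)\to(H,\mathcal Q)$ is a quasi-isometry of pairs, and that $q\colon\Gamma(G,S)\to\Gamma(H,T)$ is a quasi-isometry. Then: 1. If $\mathcal P$ and $\mathcal Q$ are reduced, then $\mathcal P\hookrightarrow_h(G,S)$ if and only if $\mathcal Q\hookrightarrow_h(H,T)$. 2. If every member of $\mathcal Q$ is infinite and $\mathcal Q\hookrightarrow_h(H,T)$, then $\mathcal P^*\hookrightarrow_h(G,S)$ for every refinement $\mathcal P^*$ of $\mathcal P$. -/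

import Mathlib

open scoped Pointwise

/-! Word metrics are graph metrics of `SimpleGraph.mulCayley S`, the Cayley graph of `G` with
vertex set `G` and edges `{g, gs}`, `s ∈ S` (loops are irrelevant for the metric). -/

section Graphs

variable {X Y : Type*}

/-- `f : X → Y` is an `(L, C)`-quasi-isometry between the vertex sets of two (connected) graphs,
with their graph metrics. -/
def IsQuasiIsometryWith (Γ : SimpleGraph X) (Δ : SimpleGraph Y) (L C : ℝ) (f : X → Y) : Prop :=
  1 ≤ L ∧ 0 ≤ C ∧
  (∀ x x' : X, L⁻¹ * (Γ.dist x x' : ℝ) - C ≤ (Δ.dist (f x) (f x') : ℝ) ∧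
    (Δ.dist (f x) (f x') : ℝ) ≤ L * (Γ.dist x x' : ℝ) + C) ∧
  ∀ y : Y, ∃ x : X, (Δ.dist (f x) y : ℝ) ≤ C

/-- `f` is a quasi-isometry between the vertex sets of two (connected) graphs. -/
def IsQuasiIsometry (Γ : SimpleGraph X) (Δ : SimpleGraph Y) (f : X → Y) : Prop :=
  ∃ L C : ℝ, IsQuasiIsometryWith Γ Δ L C f

/-- The Hausdorff distance of the vertex sets `A` and `B` of a (connected) graph is `< M`: there
is `0 ≤ r < M` such that each set is contained in the closed `r`-neighbourhood of the other. -/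
def HausdorffDistLT (Δ : SimpleGraph Y) (A B : Set Y) (M : ℝ) : Prop :=
  ∃ r : ℝ, 0 ≤ r ∧ r < M ∧ (∀ a ∈ A, ∃ b ∈ B, (Δ.dist a b : ℝ) ≤ r) ∧
    ∀ b ∈ B, ∃ a ∈ A, (Δ.dist a b : ℝ) ≤ r

/-- A connected graph is hyperbolic if for some `δ` all its geodesic triangles are `δ`-slim. -/
def IsHyperbolicGraph (Γ : SimpleGraph X) : Prop :=
  Γ.Connected ∧ ∃ δ : ℕ, ∀ (x y z : X) (p : Γ.Walk x y) (p' : Γ.Walk y z) (p'' : Γ.Walk x z),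
    p.length = Γ.dist x y → p'.length = Γ.dist y z → p''.length = Γ.dist x z →
    ∀ u ∈ p.support, ∃ v, (v ∈ p'.support ∨ v ∈ p''.support) ∧ Γ.dist u v ≤ δ

end Graphs

section Groups

variable {G H : Type*} [Group G] [Group H]

/-- `G/𝔓`: the set of all left cosets `gP` with `g ∈ G` and `P ∈ 𝔓`. -/
def cosetsOf (𝔓 : Set (Subgroup G)) : Set (Set G) :=
  {A | ∃ g : G, ∃ P ∈ 𝔓, A = g • (P : Set G)}

/-- `q` is a quasi-isometry of pairs `(G, 𝔓) → (H, 𝔔)` for the word metrics of `S₀` and `T₀`. -/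
def IsQuasiIsometryOfPairs (S₀ : Set G) (T₀ : Set H) (𝔓 : Set (Subgroup G))
    (𝔔 : Set (Subgroup H)) (q : G → H) : Prop :=
  IsQuasiIsometry (SimpleGraph.mulCayley S₀) (SimpleGraph.mulCayley T₀) q ∧
  ∃ M : ℝ, 0 < M ∧
    (∀ A ∈ cosetsOf 𝔓, ∃ B ∈ cosetsOf 𝔔,
      HausdorffDistLT (SimpleGraph.mulCayley T₀) (q '' A) B M) ∧
    (∀ B ∈ cosetsOf 𝔔, ∃ A ∈ cosetsOf 𝔓,
      HausdorffDistLT (SimpleGraph.mulCayley T₀) (q '' A) B M)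

/-- `𝔓` is reduced: if `P` and `gQg⁻¹` are commensurable (`P, Q ∈ 𝔓`, `g ∈ G`), then `P = Q` and
`g ∈ P`. Here `ConjAct.toConjAct g • Q` is `gQg⁻¹`. -/
def IsReducedCollection (𝔓 : Set (Subgroup G)) : Prop :=
  ∀ P ∈ 𝔓, ∀ Q ∈ 𝔓, ∀ g : G,
    Subgroup.Commensurable P (ConjAct.toConjAct g • Q) → P = Q ∧ g ∈ P

/-- The collection of all commensurators `Comm_G(gPg⁻¹)`, `P ∈ 𝔓`, `g ∈ G`. -/
def commensurators (𝔓 : Set (Subgroup G)) : Set (Subgroup G) :=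
  {K | ∃ P ∈ 𝔓, ∃ g : G, K = Subgroup.Commensurable.commensurator (ConjAct.toConjAct g • P)}

/-- `ℛ` is a refinement of `𝔓`: a set of representatives of the conjugacy classes of the
collection `commensurators 𝔓`, with exactly one representative for each class. -/
def IsRefinement (𝔓 ℛ : Set (Subgroup G)) : Prop :=
  ℛ ⊆ commensurators 𝔓 ∧
  ∀ K ∈ commensurators 𝔓, ∃! R, R ∈ ℛ ∧ ∃ g : G, R = ConjAct.toConjAct g • K

/-- The Cayley graph `Γ(G, X ⊔ 𝓗)` for the alphabet `𝓗 = ⨆_{P ∈ 𝔓} P`; parallel edges are merged,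
which does not change the graph metric. -/
def relCayleyGraph (X : Set G) (𝔓 : Set (Subgroup G)) : SimpleGraph G :=
  SimpleGraph.mulCayley (X ∪ ⋃ P ∈ 𝔓, (P : Set G))

/-- `Γ(G, X ⊔ 𝓗)` without the edges of its complete subgraph `Γ(P, P)`, i.e. those that join two
elements of `P` and are labelled by a letter of the copy of `P` in `𝓗`. As the alphabet is a
disjoint union, an edge between two elements of `P` labelled by a letter of `X`, or of another
member of the collection, is kept. -/
def admissibleGraph (X : Set G) (𝔓 : Set (Subgroup G)) (P : Subgroup G) : SimpleGraph G where
  Adj u v := (SimpleGraph.mulCayley X).Adj u v ∨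
    ∃ Q ∈ 𝔓, (SimpleGraph.mulCayley (Q : Set G)).Adj u v ∧ ¬ (Q = P ∧ u ∈ P ∧ v ∈ P)
  symm := ⟨by
    rintro u v (h | ⟨Q, hQ, h, hn⟩)
    · exact Or.inl h.symm
    · exact Or.inr ⟨Q, hQ, h.symm, fun ⟨h1, h2, h3⟩ => hn ⟨h1, h3, h2⟩⟩⟩
  loopless := ⟨by
    rintro u (h | ⟨Q, _, h, _⟩)
    · exact h.ne rfl
    · exact h.ne rfl⟩

/-- The relative metric on `P` with values in `[0, ∞]`: the length of a shortest path in
`Γ(G, X ⊔ 𝓗)` that contains no edge of `Γ(P, P)`. -/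
noncomputable def relMetric (X : Set G) (𝔓 : Set (Subgroup G)) (P : Subgroup G) (g h : G) : ℕ∞ :=
  (admissibleGraph X 𝔓 P).edist g h

/-- `𝔓 ↪_h (G, X)`: the collection `𝔓` is hyperbolically embedded in `G` with respect to `X`.
That is, `G` is generated by `X` and the members of `𝔓`, the graph `Γ(G, X ⊔ 𝓗)` is hyperbolic, and
every `P ∈ 𝔓` with its relative metric is locally finite (balls of finite radius are finite). -/
def HypEmbedded (𝔓 : Set (Subgroup G)) (X : Set G) : Prop :=
  Subgroup.closure (X ∪ ⋃ P ∈ 𝔓, (P : Set G)) = ⊤ ∧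
  IsHyperbolicGraph (relCayleyGraph X 𝔓) ∧
  ∀ P ∈ 𝔓, ∀ g ∈ P, ∀ n : ℕ, {h : G | h ∈ P ∧ relMetric X 𝔓 P g h ≤ n}.Finite

end Groups

/-!
The quasi-isometry `q` of finitely generated groups has a quasi-inverse `r`, and both are coarse
equivalences for the left-invariant coarse structures in which `A` is near `B` if `A ⊆ B * E` for a
finite set `E`. They are moreover Lipschitz for the word metrics of `S` and `T`
(`exists_isCoarseInverse`). In this language a quasi-isometry of pairs is a matching of the cosets
in `G/𝔓` with those in `H/𝔔`, up to a uniform finite error (`IsCosetMatching`).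

The core is `IsCoarseInverse.hypEmbedded`: if distinct cosets in `G/𝔓` are never close to each other
(`IsCoarselySeparated`), then `𝔔 ↪_h (H, T)` implies `𝔓 ↪_h (G, S)`.

* Hyperbolicity: `q` and `r` are Lipschitz maps between the relative Cayley graphs and `r ∘ q` is
  near the identity, so the `r`-images of geodesics form a thin family of paths in
  `Γ(G, S ⊔ 𝓗)`. A connected graph with such a family is hyperbolic
  (`SimpleGraph.IsThinFamily.isHyperbolicGraph`). For this one compares the family with geodesics: it
  is within a logarithmic distance of any path by bisection, and this bootstraps to a uniform bound
  for geodesics.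
* Local finiteness: by separation, distinct cosets have distinct matches. Hence `q` sends a path that
  avoids the edges inside `P` to one, longer by a constant factor, that avoids the edges inside the
  match of `P`, and preimages of finite sets under `q` are finite.

A reduced collection is coarsely separated, because two cosets `gP` and `g'Q` are close exactly when
`gPg⁻¹` and `g'Qg'⁻¹` are commensurable (`areClose_smul_iff`). So the first claim follows from the
core lemma applied to `q` and to `r`.

For the second claim, infinite hyperbolically embedded subgroups are coarsely separated
(`HypEmbedded.isCoarselySeparated`), so close cosets in `G/𝔓` have the same match and are
*uniformly* close. In particular all translates `cgP` by `c ∈ Comm(gPg⁻¹)` are uniformly close to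
`gP`, so `gPg⁻¹` has finite index in its commensurator. Therefore the cosets of a refinement are
uniformly close to cosets in `G/𝔓` and are matched with `H/𝔔`, and they are coarsely separated
because the members of a refinement are pairwise non-conjugate and equal to their own commensurators.
-/

/-! ### Hyperbolicity from a thin family of paths -/

/-- Exponential growth beats linear growth. -/
theorem exists_forall_linear_le_two_pow (A B : ℕ) : ∃ n₀ : ℕ, ∀ n ≥ n₀, A * n + B ≤ 2 ^ n := by
  refine ⟨3 * (A + B + 2), fun n hn => ?_⟩
  induction n, hn using Nat.le_induction with
  | base =>
    have h : A + B + 2 + 1 ≤ 2 ^ (A + B + 2) := Nat.lt_two_pow_self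
    have h3 : (A + B + 2 + 1) ^ 3 ≤ 2 ^ (3 * (A + B + 2)) := by
      rw [mul_comm, pow_mul]
      exact Nat.pow_le_pow_left h 3
    refine le_trans ?_ h3
    ring_nf
    nlinarith [Nat.zero_le (A ^ 2 * B), Nat.zero_le (A * B ^ 2), Nat.zero_le (A ^ 3),
      Nat.zero_le (B ^ 3), Nat.zero_le (A * B), Nat.zero_le (A ^ 2), Nat.zero_le (B ^ 2)]
  | succ n hn ih =>
    rw [pow_succ]
    have : A * 1 ≤ A * n := Nat.mul_le_mul_left A (by omega)
    rw [mul_add]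
    omega

/-- The radius `R` of the stability lemma `exists_dist_le_of_mem_of_geodesic`: a distance `t`
beyond `R` exceeds every bound that is logarithmic in `t`. -/
theorem exists_forall_log_bound_lt (h : ℕ) (hh : 1 ≤ h) :
    ∃ R : ℕ, 2 * h ≤ R ∧ ∀ t > R, ∃ n : ℕ, 4 * t + 4 * h + 2 ≤ 2 ^ n ∧ h * n + 3 * h < t := by
  obtain ⟨n₀, hn₀⟩ := exists_forall_linear_le_two_pow (4 * h) (20 * h + 2)
  refine ⟨h * n₀ + 3 * h, by omega, fun t ht => ⟨(t - 3 * h - 1) / h, ?_, ?_⟩⟩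
  · have h1 : n₀ ≤ (t - 3 * h - 1) / h := by
      rw [Nat.le_div_iff_mul_le hh, mul_comm]; omega
    have h2 := hn₀ _ h1
    have h3 := Nat.lt_mul_div_succ (t - 3 * h - 1) hh
    rw [mul_add, mul_one] at h3
    refine le_trans ?_ h2
    rw [mul_assoc]
    omega
  · have := Nat.mul_div_le (t - 3 * h - 1) h
    omega

namespace SimpleGraph

variable {X Y : Type*} {Γ : SimpleGraph X} {Δ : SimpleGraph Y}

theorem Connected.dist_le_sub (hΓ : Γ.Connected) {γ : ℕ → X}
    (hγ : ∀ i, Γ.dist (γ i) (γ (i + 1)) ≤ 1) {i j : ℕ} (hij : i ≤ j) :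
    Γ.dist (γ i) (γ j) ≤ j - i := by
  induction j, hij using Nat.le_induction with
  | base => simp
  | succ j hij ih =>
    have := hΓ.dist_triangle (u := γ i) (v := γ j) (w := γ (j + 1))
    have := hγ j
    omega

theorem Walk.dist_getVert_succ_le {x y : X} (p : Γ.Walk x y) (i : ℕ) :
    Γ.dist (p.getVert i) (p.getVert (i + 1)) ≤ 1 := by
  rcases lt_or_ge i p.length with h | h
  · exact (dist_eq_one_iff_adj.2 (p.adj_getVert_succ h)).le
  · rw [p.getVert_of_length_le h, p.getVert_of_length_le (h.trans (Nat.le_succ i)), dist_self]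
    exact zero_le_one

theorem Walk.dist_getVert_of_length_eq_dist (hΓ : Γ.Connected) {x y : X} (p : Γ.Walk x y)
    (hp : p.length = Γ.dist x y) {i j : ℕ} (hij : i ≤ j) (hj : j ≤ p.length) :
    Γ.dist (p.getVert i) (p.getVert j) = j - i := by
  have h1 := hΓ.dist_le_sub p.dist_getVert_succ_le hij
  have h2 := hΓ.dist_le_sub p.dist_getVert_succ_le (Nat.zero_le i)
  have h3 := hΓ.dist_le_sub p.dist_getVert_succ_le hj
  rw [p.getVert_zero] at h2
  rw [p.getVert_length] at h3
  have h4 := hΓ.dist_triangle (u := x) (v := p.getVert i) (w := y)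
  have h5 := hΓ.dist_triangle (u := p.getVert i) (v := p.getVert j) (w := y)
  omega

/-- A family of subsets `L x y` of the vertex set, coarsely connected from `x` to `y`, of bounded
size for neighbouring `x` and `y`, whose triangles are `h`-thin. -/
structure IsThinFamily (Γ : SimpleGraph X) (h : ℕ) (L : X → X → Set X) : Prop where
  right_mem : ∀ x y, y ∈ L x y
  exists_crossing : ∀ x y (Q : X → Prop), Q x → ¬ Q y →
    ∃ w ∈ L x y, ∃ w' ∈ L x y, Q w ∧ ¬ Q w' ∧ Γ.dist w w' ≤ h
  dist_le : ∀ x y, Γ.dist x y ≤ 1 → ∀ w ∈ L x y, Γ.dist x w ≤ h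
  thin : ∀ x y z, ∀ w ∈ L x y, ∃ w', (w' ∈ L x z ∨ w' ∈ L z y) ∧ Γ.dist w w' ≤ h

namespace IsThinFamily

variable {h : ℕ} {L : X → X → Set X}

/-- By repeated bisection, `L` stays within a distance logarithmic in the length of any path. -/
theorem exists_dist_le_log (hL : Γ.IsThinFamily h L) (hΓ : Γ.Connected) {γ : ℕ → X}
    (hγ : ∀ i, Γ.dist (γ i) (γ (i + 1)) ≤ 1) (n : ℕ) :
    ∀ a b, a ≤ b → b - a ≤ 2 ^ n → ∀ w ∈ L (γ a) (γ b),
      ∃ i, a ≤ i ∧ i ≤ b ∧ Γ.dist w (γ i) ≤ h * n + h := by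
  induction n with
  | zero =>
    intro a b hab hb w hw
    refine ⟨a, le_rfl, hab, ?_⟩
    rw [dist_comm]
    have := hL.dist_le _ _ ((hΓ.dist_le_sub hγ hab).trans (by simpa using hb)) w hw
    omega
  | succ n ih =>
    intro a b hab hb w hw
    rw [pow_succ] at hb
    obtain ⟨w', hw', hd⟩ := hL.thin _ _ (γ (min (a + 2 ^ n) b)) w hw
    rw [mul_add]
    rcases hw' with hw' | hw'
    · obtain ⟨i, h1, h2, h3⟩ := ih _ _ (by omega) (by omega) w' hw'
      have := hΓ.dist_triangle (u := w) (v := w') (w := γ i)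
      exact ⟨i, h1, by omega, by omega⟩
    · obtain ⟨i, h1, h2, h3⟩ := ih _ _ (by omega) (by omega) w' hw'
      have := hΓ.dist_triangle (u := w) (v := w') (w := γ i)
      exact ⟨i, by omega, h2, by omega⟩

/-- `L` stays within a bounded distance of geodesics. -/
theorem exists_dist_le_of_mem_of_geodesic (hL : Γ.IsThinFamily h L) (hΓ : Γ.Connected)
    {R : ℕ} (hR : 2 * h ≤ R)
    (hlog : ∀ t > R, ∃ n : ℕ, 4 * t + 4 * h + 2 ≤ 2 ^ n ∧ h * n + 3 * h < t)
    {γ : ℕ → X} {N : ℕ} (hγ : ∀ i, Γ.dist (γ i) (γ (i + 1)) ≤ 1)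
    (hgeo : ∀ i j, i ≤ j → j ≤ N → Γ.dist (γ i) (γ j) = j - i) (a b : ℕ) (hab : a ≤ b)
    (hb : b ≤ N) : ∀ w ∈ L (γ a) (γ b), ∃ i, a ≤ i ∧ i ≤ b ∧ Γ.dist w (γ i) ≤ R := by
  induction hm : b - a using Nat.strong_induction_on generalizing a b with
  | _ m ih =>
  intro w hw
  obtain ⟨i, hi, hmin⟩ := (Finset.Icc a b).exists_min_image (fun i => Γ.dist w (γ i))
    ⟨a, Finset.mem_Icc.2 ⟨le_rfl, hab⟩⟩
  rw [Finset.mem_Icc] at hi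
  refine ⟨i, hi.1, hi.2, ?_⟩
  replace hmin : ∀ j, a ≤ j → j ≤ b → Γ.dist w (γ i) ≤ Γ.dist w (γ j) :=
    fun j h1 h2 => hmin j (Finset.mem_Icc.2 ⟨h1, h2⟩)
  by_contra! ht
  generalize hteq : Γ.dist w (γ i) = t at *
  obtain ⟨n, hn1, hn2⟩ := hlog t ht
  have hdeg : ∀ c, a ≤ c → c ≤ b → ∀ v ∈ L (γ c) (γ c), Γ.dist w v ≤ 2 * h → t ≤ 3 * h := by
    intro c hac hcb v hv hd
    have h1 := hL.dist_le (γ c) (γ c) (by simp) v hv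
    have h2 := hmin c hac hcb
    have h3 := hΓ.dist_triangle (u := w) (v := v) (w := γ c)
    rw [dist_comm] at h1
    omega
  -- Points of the geodesic at distance at least `t + R + 2h + 1` from `γ i` cannot be close to a
  -- point of `L` near `w`, so only the middle part of the geodesic matters.
  set D := t + R + 2 * h + 1 with hD
  obtain ⟨w₁, hw₁, hd₁⟩ := hL.thin _ _ (γ (max a (i - D))) w hw
  rcases hw₁ with hw₁ | hw₁
  · rcases le_or_gt (i - D) a with hc | hc
    · rw [max_eq_left hc] at hw₁
      have := hdeg a le_rfl hab w₁ hw₁ (by omega)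
      omega
    · rw [max_eq_right hc.le] at hw₁
      obtain ⟨j, hj1, hj2, hj3⟩ := ih (i - D - a) (by omega) a (i - D) hc.le (by omega) rfl w₁ hw₁
      have h1 := hgeo j i (by omega) (by omega)
      have h2 := hΓ.dist_triangle (u := γ j) (v := w) (w := γ i)
      have h3 := hΓ.dist_triangle (u := w) (v := w₁) (w := γ j)
      rw [dist_comm (u := γ j) (v := w)] at h2
      omega
  obtain ⟨w₂, hw₂, hd₂⟩ := hL.thin _ _ (γ (min b (i + D))) w₁ hw₁
  have hww₂ := hΓ.dist_triangle (u := w) (v := w₁) (w := w₂)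
  rcases hw₂ with hw₂ | hw₂
  · obtain ⟨j, hj1, hj2, hj3⟩ := hL.exists_dist_le_log hΓ hγ n _ _ (by omega) (by omega) w₂ hw₂
    have h1 := hmin j (by omega) (by omega)
    have h2 := hΓ.dist_triangle (u := w) (v := w₂) (w := γ j)
    omega
  · rcases le_or_gt b (i + D) with hc | hc
    · rw [min_eq_left hc] at hw₂
      have := hdeg b hab le_rfl w₂ hw₂ (by omega)
      omega
    · rw [min_eq_right hc.le] at hw₂
      obtain ⟨j, hj1, hj2, hj3⟩ := ih (b - (i + D)) (by omega) (i + D) b hc.le hb rfl w₂ hw₂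
      have h1 := hgeo i j (by omega) (by omega)
      have h2 := hΓ.dist_triangle (u := γ i) (v := w) (w := γ j)
      have h3 := hΓ.dist_triangle (u := w) (v := w₂) (w := γ j)
      rw [dist_comm (u := γ i) (v := w)] at h2
      omega

/-- Conversely geodesics stay within a bounded distance of `L`, since `L` is coarsely connected and
runs along the geodesic. -/
theorem exists_mem_dist_le_of_geodesic (hL : Γ.IsThinFamily h L) (hΓ : Γ.Connected)
    {R : ℕ} {γ : ℕ → X} {N : ℕ}
    (hgeo : ∀ i j, i ≤ j → j ≤ N → Γ.dist (γ i) (γ j) = j - i)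
    (hnear : ∀ w ∈ L (γ 0) (γ N), ∃ i, i ≤ N ∧ Γ.dist w (γ i) ≤ R) (s : ℕ) (hs : s ≤ N) :
    ∃ w ∈ L (γ 0) (γ N), Γ.dist (γ s) w ≤ 3 * R + h := by
  by_cases hN : ∃ i ≤ s, Γ.dist (γ N) (γ i) ≤ R
  · obtain ⟨i, hi, hd⟩ := hN
    refine ⟨γ N, hL.right_mem _ _, ?_⟩
    have h1 := hgeo s N hs le_rfl
    have h2 := hgeo i N (hi.trans hs) le_rfl
    rw [dist_comm] at h2
    omega
  · obtain ⟨w, hw, w', hw', ⟨i, hi, hwi⟩, hnot, hd⟩ :=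
      hL.exists_crossing (γ 0) (γ N) (fun w => ∃ i ≤ s, Γ.dist w (γ i) ≤ R)
        ⟨0, Nat.zero_le s, by simp⟩ hN
    obtain ⟨j, hj, hwj⟩ := hnear w' hw'
    have hsj : s < j := by
      by_contra! hjs
      exact hnot ⟨j, hjs, hwj⟩
    refine ⟨w, hw, ?_⟩
    have h1 := hgeo i s hi hs
    have h2 := hgeo i j (by omega) hj
    have h3 := hΓ.dist_triangle (u := γ i) (v := w) (w := γ j)
    have h4 := hΓ.dist_triangle (u := w) (v := w') (w := γ j)
    have h5 := hΓ.dist_triangle (u := γ s) (v := γ i) (w := w)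
    rw [dist_comm] at hwi h1
    omega

/-- A connected graph with a thin family is hyperbolic ("guessing geodesics"). -/
theorem isHyperbolicGraph (hL : Γ.IsThinFamily h L) (hΓ : Γ.Connected) (hh : 1 ≤ h) :
    IsHyperbolicGraph Γ := by
  obtain ⟨R, hR, hlog⟩ := exists_forall_log_bound_lt h hh
  have near : ∀ {x y : X} (p : Γ.Walk x y), p.length = Γ.dist x y → ∀ w ∈ L x y,
      ∃ v ∈ p.support, Γ.dist w v ≤ R := by
    intro x y p hp w hw
    obtain ⟨i, -, -, hi⟩ := hL.exists_dist_le_of_mem_of_geodesic hΓ hR hlog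
      p.dist_getVert_succ_le (fun i j => p.dist_getVert_of_length_eq_dist hΓ hp)
      0 p.length (Nat.zero_le _) le_rfl w (by simpa using hw)
    exact ⟨_, p.getVert_mem_support i, hi⟩
  refine ⟨hΓ, 4 * R + 2 * h, fun x y z p p' p'' hp hp' hp'' u hu => ?_⟩
  obtain ⟨s, rfl, hs⟩ := Walk.mem_support_iff_exists_getVert.1 hu
  obtain ⟨w, hw, hd⟩ := hL.exists_mem_dist_le_of_geodesic hΓ (γ := p.getVert) (R := R)
    (fun i j => p.dist_getVert_of_length_eq_dist hΓ hp) (fun w hw => by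
      obtain ⟨v, hv, hd⟩ := near p hp w (by simpa using hw)
      obtain ⟨i, rfl, hi⟩ := Walk.mem_support_iff_exists_getVert.1 hv
      exact ⟨i, hi, hd⟩) s hs
  rw [p.getVert_zero, p.getVert_length] at hw
  obtain ⟨w', hw', hd'⟩ := hL.thin x y z w hw
  have h1 := hΓ.dist_triangle (u := p.getVert s) (v := w) (w := w')
  rcases hw' with hw' | hw'
  · obtain ⟨v, hv, hvd⟩ := near p'' hp'' w' hw'
    have h2 := hΓ.dist_triangle (u := p.getVert s) (v := w') (w := v)
    exact ⟨v, Or.inr hv, by omega⟩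
  · obtain ⟨v, hv, hvd⟩ := near p'.reverse (by rw [Walk.length_reverse, hp', dist_comm]) w' hw'
    have h2 := hΓ.dist_triangle (u := p.getVert s) (v := w') (w := v)
    exact ⟨v, Or.inl (by simpa using hv), by omega⟩

end IsThinFamily

/-- A map that is `K`-Lipschitz on edges is `K`-Lipschitz. -/
theorem Connected.dist_map_le (hΓ : Γ.Connected) (hΔ : Δ.Connected) {f : X → Y} {K : ℕ}
    (hf : ∀ x x', Γ.Adj x x' → Δ.dist (f x) (f x') ≤ K) (x x' : X) :
    Δ.dist (f x) (f x') ≤ K * Γ.dist x x' := by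
  obtain ⟨p, hp⟩ := hΓ.exists_walk_length_eq_dist x x'
  rw [← hp]
  clear hp
  induction p with
  | nil => simp
  | @cons u v w h p ih =>
    have h1 := hf _ _ h
    have h2 := hΔ.dist_triangle (u := f u) (v := f v) (w := f w)
    rw [Walk.length_cons, mul_add, mul_one]
    omega

/-- A coarse Lipschitz retract of a hyperbolic graph is hyperbolic: the images of geodesics under
the retraction form a thin family. -/
theorem Connected.isHyperbolicGraph_of_retract (hΓ : Γ.Connected) (hΔ : IsHyperbolicGraph Δ)
    {f : X → Y} {r : Y → X} {K : ℕ} (hf : ∀ x x', Γ.Adj x x' → Δ.dist (f x) (f x') ≤ K)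
    (hr : ∀ y y', Δ.Adj y y' → Γ.dist (r y) (r y') ≤ K) (hrf : ∀ x, Γ.dist (r (f x)) x ≤ K) :
    IsHyperbolicGraph Γ := by
  obtain ⟨hΔc, δ, hδ⟩ := hΔ
  have hf' := hΓ.dist_map_le hΔc hf
  have hr' := hΔc.dist_map_le hΓ hr
  let L : X → X → Set X := fun x y => {w | ∃ p : Δ.Walk (f x) (f y),
    p.length = Δ.dist (f x) (f y) ∧ ∃ v ∈ p.support, Γ.dist w (r v) ≤ K}
  have hx : ∀ x y, x ∈ L x y := fun x y => by
    obtain ⟨p, hp⟩ := hΔc.exists_walk_length_eq_dist (f x) (f y)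
    exact ⟨p, hp, f x, p.start_mem_support, by rw [dist_comm]; exact hrf x⟩
  have hy : ∀ x y, y ∈ L x y := fun x y => by
    obtain ⟨p, hp⟩ := hΔc.exists_walk_length_eq_dist (f x) (f y)
    exact ⟨p, hp, f y, p.end_mem_support, by rw [dist_comm]; exact hrf y⟩
  have hL : Γ.IsThinFamily (K * δ + K * K + 2 * K + 1) L := by
    refine ⟨hy, ?_, ?_, ?_⟩
    · intro x y Q hQx hQy
      by_contra! hcon
      replace hcon : ∀ w ∈ L x y, ∀ w' ∈ L x y, Γ.dist w w' ≤ K → Q w → Q w' := by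
        intro w hw w' hw' hd hQ
        by_contra hQ'
        have := hcon w hw w' hw' hQ hQ'
        nlinarith
      obtain ⟨p, hp⟩ := hΔc.exists_walk_length_eq_dist (f x) (f y)
      have hmem : ∀ i, r (p.getVert i) ∈ L x y := fun i =>
        ⟨p, hp, _, p.getVert_mem_support i, by simp⟩
      have hQ : ∀ i, Q (r (p.getVert i)) := by
        intro i
        induction i with
        | zero =>
          refine hcon x (hx x y) _ (hmem 0) ?_ hQx
          rw [p.getVert_zero, dist_comm]
          exact hrf x
        | succ i ih =>
          refine hcon _ (hmem i) _ (hmem _) ((hr' _ _).trans ?_) ih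
          simpa using Nat.mul_le_mul_left K (p.dist_getVert_succ_le i)
      refine hQy (hcon _ (hmem p.length) y (hy x y) ?_ (hQ _))
      rw [p.getVert_length]
      exact hrf y
    · rintro x y hxy w ⟨p, hp, v, hv, hwv⟩
      obtain ⟨i, rfl, hi⟩ := Walk.mem_support_iff_exists_getVert.1 hv
      have h1 : Δ.dist (f x) (p.getVert i) ≤ K := by
        have h2 := hΔc.dist_le_sub p.dist_getVert_succ_le (Nat.zero_le i)
        rw [p.getVert_zero] at h2
        have h3 := (hf' x y).trans (Nat.mul_le_mul_left K hxy)
        omega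
      have h2 := (hr' (f x) (p.getVert i)).trans (Nat.mul_le_mul_left K h1)
      have h3 := hΓ.dist_triangle (u := x) (v := r (f x)) (w := r (p.getVert i))
      have h4 := hΓ.dist_triangle (u := x) (v := r (p.getVert i)) (w := w)
      have h5 := hrf x
      rw [dist_comm] at h5 hwv
      omega
    · rintro x y z w ⟨p, hp, v, hv, hwv⟩
      obtain ⟨p', hp'⟩ := hΔc.exists_walk_length_eq_dist (f y) (f z)
      obtain ⟨p'', hp''⟩ := hΔc.exists_walk_length_eq_dist (f x) (f z)
      obtain ⟨v', hv', hd⟩ := hδ _ _ _ p p' p'' hp hp' hp'' v hv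
      refine ⟨r v', ?_, ?_⟩
      · rcases hv' with hv' | hv'
        · exact Or.inr ⟨p'.reverse, by rw [Walk.length_reverse, hp', dist_comm], v',
            by simpa using hv', by simp⟩
        · exact Or.inl ⟨p'', hp'', v', hv', by simp⟩
      · have h1 := (hr' v v').trans (Nat.mul_le_mul_left K hd)
        have h2 := hΓ.dist_triangle (u := w) (v := r v) (w := r v')
        omega
  exact hL.isHyperbolicGraph hΓ (by omega)

end SimpleGraph

/-! ### Cayley graphs -/

namespace SimpleGraph

variable {X Y : Type*} {Γ : SimpleGraph X} {Δ : SimpleGraph Y}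

/-- Version of `SimpleGraph.Connected.dist_map_le` for extended distances, which needs no
connectedness. -/
theorem edist_map_le {f : X → Y} {K : ℕ}
    (hf : ∀ x x', Γ.Adj x x' → Δ.edist (f x) (f x') ≤ K) {n : ℕ} {x x' : X}
    (h : Γ.edist x x' ≤ n) : Δ.edist (f x) (f x') ≤ (K * n : ℕ) := by
  have key : ∀ {u v : X} (p : Γ.Walk u v), Δ.edist (f u) (f v) ≤ (K * p.length : ℕ) := by
    intro u v p
    induction p with
    | nil => simp
    | @cons u v w h p ih =>
      refine (SimpleGraph.edist_triangle (v := f v)).trans ((add_le_add (hf _ _ h) ih).trans_eq ?_)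
      rw [Walk.length_cons]
      push_cast
      ring
  obtain ⟨p, hp⟩ := exists_walk_of_edist_ne_top (ne_top_of_le_ne_top (ENat.natCast_ne_top n) h)
  rw [← hp] at h
  exact (key p).trans (Nat.cast_le.2 (Nat.mul_le_mul_left K (Nat.cast_le.1 h)))

end SimpleGraph

section Cayley

open SimpleGraph

variable {G H : Type*} [Group G] [Group H]

theorem mulCayley_connected {S : Set G} (hS : Subgroup.closure S = ⊤) :
    (mulCayley S).Connected := by
  have hmul : ∀ (g u v : G), (mulCayley S).Reachable u v →
      (mulCayley S).Reachable (g * u) (g * v) := by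
    intro g u v h
    let φ : mulCayley S →g mulCayley S := ⟨fun x => g * x, fun h => mulCayley_adj_mul_iff_right.2 h⟩
    exact h.map φ
  have h1 : ∀ g : G, (mulCayley S).Reachable 1 g := by
    intro g
    have hg : g ∈ Subgroup.closure S := hS ▸ Subgroup.mem_top g
    induction hg using Subgroup.closure_induction with
    | mem x hx =>
      by_cases h : (1 : G) = x
      · rw [← h]
      · exact (show (mulCayley S).Adj 1 x from (mulCayley_adj S 1 x).2
          ⟨h, Or.inl (by simpa using hx)⟩).reachable
    | one => exact Reachable.refl _
    | mul x y _ _ hx hy => exact hx.trans (by simpa using hmul x 1 y hy)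
    | inv x _ hx => simpa using (hmul x⁻¹ 1 x hx).symm
  have : Nonempty G := ⟨1⟩
  exact ⟨fun u v => (h1 u).symm.trans (h1 v)⟩

theorem mulCayley_dist_mul_left {S : Set G} (hS : Subgroup.closure S = ⊤) (g u v : G) :
    (mulCayley S).dist (g * u) (g * v) = (mulCayley S).dist u v := by
  have hc := mulCayley_connected hS
  have key : ∀ g u v : G, (mulCayley S).dist (g * u) (g * v) ≤ (mulCayley S).dist u v := by
    intro g u v
    have := hc.dist_map_le hc (f := fun x => g * x) (K := 1)
      (fun x x' h => (dist_eq_one_iff_adj.2 (mulCayley_adj_mul_iff_right.2 h)).le) u v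
    simpa using this
  refine le_antisymm (key g u v) ?_
  simpa using key g⁻¹ (g * u) (g * v)

/-- Finite sets have bounded word length, for any generating set. -/
theorem exists_mulCayley_dist_le {S : Set G} (hS : Subgroup.closure S = ⊤) {E : Set G}
    (hE : E.Finite) : ∃ N : ℕ, ∀ x y : G, x⁻¹ * y ∈ E → (mulCayley S).dist x y ≤ N := by
  obtain ⟨N, hN⟩ := (hE.image fun e => (mulCayley S).dist 1 e).bddAbove
  refine ⟨N, fun x y h => ?_⟩
  rw [← mulCayley_dist_mul_left hS x⁻¹, inv_mul_cancel]
  exact hN ⟨_, h, rfl⟩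

/-- Balls of a word metric for a finite generating set are finite. -/
theorem exists_finite_of_mulCayley_dist_le {S : Set G} (hfin : S.Finite)
    (hS : Subgroup.closure S = ⊤) (n : ℕ) :
    ∃ F : Set G, F.Finite ∧ ∀ x y : G, (mulCayley S).dist x y ≤ n → x⁻¹ * y ∈ F := by
  suffices h : ∃ F : Set G, F.Finite ∧ ∀ x y : G, ∀ p : (mulCayley S).Walk x y,
      p.length ≤ n → x⁻¹ * y ∈ F by
    obtain ⟨F, hF, h⟩ := h
    refine ⟨F, hF, fun x y hxy => ?_⟩
    obtain ⟨p, hp⟩ := (mulCayley_connected hS).exists_walk_length_eq_dist x y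
    exact h x y p (hp.trans_le hxy)
  induction n with
  | zero =>
    refine ⟨{1}, Set.finite_singleton 1, fun x y p hp => ?_⟩
    have := Walk.eq_of_length_eq_zero (Nat.le_zero.1 hp)
    simp [this]
  | succ n ih =>
    obtain ⟨F, hF, h⟩ := ih
    refine ⟨{1} ∪ (S ∪ S⁻¹) * F,
      (Set.finite_singleton 1).union ((hfin.union hfin.inv).mul hF), fun x y p hp => ?_⟩
    cases p with
    | nil => simp
    | @cons _ v _ hadj p =>
      refine Or.inr ⟨x⁻¹ * v, ?_, v⁻¹ * y, h v y p (by simpa using hp), by group⟩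
      rcases ((mulCayley_adj S x v).1 hadj).2 with h1 | h1
      · exact Or.inl h1
      · exact Or.inr (by simpa using h1)

theorem relCayleyGraph_adj_iff {X : Set G} {𝔓 : Set (Subgroup G)} {u v : G} :
    (relCayleyGraph X 𝔓).Adj u v ↔
      (mulCayley X).Adj u v ∨ u ≠ v ∧ ∃ A ∈ cosetsOf 𝔓, u ∈ A ∧ v ∈ A := by
  have hcos : (∃ P ∈ 𝔓, u⁻¹ * v ∈ P) ↔ ∃ A ∈ cosetsOf 𝔓, u ∈ A ∧ v ∈ A := by
    constructor
    · rintro ⟨P, hP, h⟩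
      exact ⟨u • (P : Set G), ⟨u, P, hP, rfl⟩, ⟨1, P.one_mem, by simp⟩,
        ⟨u⁻¹ * v, h, by simp⟩⟩
    · rintro ⟨_, ⟨g, P, hP, rfl⟩, hu, hv⟩
      rw [Set.mem_smul_set_iff_inv_smul_mem] at hu hv
      exact ⟨P, hP, by simpa [mul_assoc] using P.mul_mem (P.inv_mem hu) hv⟩
  have hinv : (∃ P ∈ 𝔓, v⁻¹ * u ∈ P) ↔ ∃ P ∈ 𝔓, u⁻¹ * v ∈ P := by
    refine exists_congr fun P => and_congr_right fun _ => ?_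
    rw [← P.inv_mem_iff]
    simp
  rw [relCayleyGraph, mulCayley_adj, mulCayley_adj]
  simp only [Set.mem_union, Set.mem_iUnion, SetLike.mem_coe, exists_prop, ← hcos, hinv]
  tauto

theorem admissibleGraph_adj_iff {X : Set G} {𝔓 : Set (Subgroup G)} {P : Subgroup G} {u v : G} :
    (admissibleGraph X 𝔓 P).Adj u v ↔ (mulCayley X).Adj u v ∨
      u ≠ v ∧ ∃ A ∈ cosetsOf 𝔓, A ≠ (P : Set G) ∧ u ∈ A ∧ v ∈ A := by
  refine or_congr_right ?_
  constructor
  · rintro ⟨Q, hQ, hadj, hn⟩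
    have hadj' := (mulCayley_adj _ _ _).1 hadj
    have huv : u⁻¹ * v ∈ Q := by
      rcases hadj'.2 with h | h
      · exact h
      · simpa using Q.inv_mem h
    refine ⟨hadj'.1, u • (Q : Set G), ⟨u, Q, hQ, rfl⟩, fun hEq => hn ?_,
      ⟨1, Q.one_mem, by simp⟩, ⟨u⁻¹ * v, huv, by simp⟩⟩
    have hu : u ∈ P := hEq.subset ⟨1, Q.one_mem, by simp⟩
    have hQP : Q = P := by
      refine SetLike.coe_injective (?_ : (Q : Set G) = P)
      rw [← smul_coe_set (inv_mem hu), ← hEq, inv_smul_smul]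
    refine ⟨hQP, hu, ?_⟩
    have := P.mul_mem hu (hQP ▸ huv)
    simpa using this
  · rintro ⟨huv, _, ⟨g, Q, hQ, rfl⟩, hne, hu, hv⟩
    rw [Set.mem_smul_set_iff_inv_smul_mem] at hu hv
    refine ⟨Q, hQ, (mulCayley_adj _ _ _).2 ⟨huv, Or.inl ?_⟩, ?_⟩
    · simpa [mul_assoc] using Q.mul_mem (Q.inv_mem hu) hv
    · rintro ⟨rfl, hu', -⟩
      refine hne ?_
      have hg : g ∈ Q := by
        have := Q.mul_mem hu' (Q.inv_mem hu)
        simpa using this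
      exact smul_coe_set hg

theorem relCayleyGraph_connected {X : Set G} (hX : Subgroup.closure X = ⊤)
    (𝔓 : Set (Subgroup G)) : (relCayleyGraph X 𝔓).Connected :=
  mulCayley_connected (top_le_iff.1 (hX ▸ Subgroup.closure_mono Set.subset_union_left))

theorem relCayleyGraph_dist_le {X : Set G} (hX : Subgroup.closure X = ⊤)
    (𝔓 : Set (Subgroup G)) (u v : G) :
    (relCayleyGraph X 𝔓).dist u v ≤ (mulCayley X).dist u v :=
  Reachable.dist_anti (mulCayley_mono Set.subset_union_left) (mulCayley_connected hX u v)

theorem relCayleyGraph_dist_le_one {X : Set G} {𝔓 : Set (Subgroup G)} {A : Set G}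
    (hA : A ∈ cosetsOf 𝔓) {u v : G} (hu : u ∈ A) (hv : v ∈ A) :
    (relCayleyGraph X 𝔓).dist u v ≤ 1 := by
  by_cases h : u = v
  · simp [h]
  · exact (dist_eq_one_iff_adj.2 (relCayleyGraph_adj_iff.2 (Or.inr ⟨h, A, hA, hu, hv⟩))).le

theorem admissibleGraph_edist_le {X : Set G} (hX : Subgroup.closure X = ⊤)
    (𝔓 : Set (Subgroup G)) (P : Subgroup G) (u v : G) :
    (admissibleGraph X 𝔓 P).edist u v ≤ (mulCayley X).dist u v := by
  rw [(mulCayley_connected hX u v).coe_dist_eq_edist]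
  exact edist_anti fun u v h => admissibleGraph_adj_iff.2 (Or.inl h)

theorem admissibleGraph_edist_le_one {X : Set G} {𝔓 : Set (Subgroup G)} {P : Subgroup G}
    {A : Set G} (hA : A ∈ cosetsOf 𝔓) (hne : A ≠ (P : Set G)) {u v : G} (hu : u ∈ A)
    (hv : v ∈ A) : (admissibleGraph X 𝔓 P).edist u v ≤ 1 := by
  rw [edist_le_one_iff_adj_or_eq]
  by_cases h : u = v
  · exact Or.inr h
  · exact Or.inl (admissibleGraph_adj_iff.2 (Or.inr ⟨h, A, hA, hne, hu, hv⟩))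

theorem coe_mem_cosetsOf {𝔓 : Set (Subgroup G)} {P : Subgroup G} (hP : P ∈ 𝔓) :
    (P : Set G) ∈ cosetsOf 𝔓 := ⟨1, P, hP, by simp⟩

theorem smul_mem_cosetsOf {𝔓 : Set (Subgroup G)} {A : Set G} (hA : A ∈ cosetsOf 𝔓) (g : G) :
    g • A ∈ cosetsOf 𝔓 := by
  obtain ⟨x, P, hP, rfl⟩ := hA
  exact ⟨g * x, P, hP, by rw [smul_smul]⟩

/-- Two points close to a coset other than `P` are joined by a short path avoiding the edges inside
`P`. -/
theorem admissibleGraph_edist_le_of_mem_mul {X : Set G} (hX : Subgroup.closure X = ⊤)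
    {𝔓 : Set (Subgroup G)} {P : Subgroup G} {A E : Set G} (hA : A ∈ cosetsOf 𝔓)
    (hne : A ≠ (P : Set G)) {N : ℕ}
    (hN : ∀ x y : G, x⁻¹ * y ∈ E → (mulCayley X).dist x y ≤ N) {u v : G} (hu : u ∈ A * E)
    (hv : v ∈ A * E) : (admissibleGraph X 𝔓 P).edist u v ≤ (2 * N + 1 : ℕ) := by
  obtain ⟨a, ha, e, he, rfl⟩ := hu
  obtain ⟨b, hb, f, hf, rfl⟩ := hv
  have h1 : (admissibleGraph X 𝔓 P).edist (a * e) a ≤ N := by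
    rw [edist_comm]
    exact (admissibleGraph_edist_le hX 𝔓 P _ _).trans (Nat.cast_le.2 (hN _ _ (by simpa)))
  have h2 : (admissibleGraph X 𝔓 P).edist b (b * f) ≤ N :=
    (admissibleGraph_edist_le hX 𝔓 P _ _).trans (Nat.cast_le.2 (hN _ _ (by simpa)))
  have h3 := admissibleGraph_edist_le_one (X := X) hA hne ha hb
  calc _ ≤ (admissibleGraph X 𝔓 P).edist (a * e) a + (admissibleGraph X 𝔓 P).edist a (b * f) :=
        SimpleGraph.edist_triangle
    _ ≤ N + (1 + N) := add_le_add h1 (SimpleGraph.edist_triangle.trans (add_le_add h3 h2))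
    _ = _ := by push_cast; ring

end Cayley

/-! ### Coarse equivalences of groups -/

section Coarse

open SimpleGraph

variable {G H : Type*} [Group G] [Group H]

/-- `f` is a controlled map for the left-invariant coarse structures given by the finite subsets:
for a finitely generated group, that of the word metric. -/
def IsControlled (f : G → H) : Prop :=
  ∀ E : Set G, E.Finite → ∃ E' : Set H, E'.Finite ∧ ∀ x y, x⁻¹ * y ∈ E → (f x)⁻¹ * f y ∈ E'

/-- `q` and `r` are mutually inverse coarse equivalences, and they are Lipschitz for the word
metrics of the possibly infinite sets `S` and `T`. The notion is symmetric. -/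
structure IsCoarseInverse (S : Set G) (T : Set H) (q : G → H) (r : H → G) : Prop where
  controlled : IsControlled q
  controlled_inv : IsControlled r
  left_inv : ∃ E : Set G, E.Finite ∧ ∀ x, x⁻¹ * r (q x) ∈ E
  right_inv : ∃ E : Set H, E.Finite ∧ ∀ y, y⁻¹ * q (r y) ∈ E
  lipschitz : ∃ K : ℕ, ∀ x x', (mulCayley S).Adj x x' → (mulCayley T).dist (q x) (q x') ≤ K
  lipschitz_inv : ∃ K : ℕ, ∀ y y', (mulCayley T).Adj y y' → (mulCayley S).dist (r y) (r y') ≤ K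

/-- Two subsets of a group are close if each lies in a neighbourhood of the other, of finite radius
with respect to the coarse structure of finite subsets. -/
def AreClose (A B : Set G) : Prop :=
  ∃ E : Set G, E.Finite ∧ A ⊆ B * E ∧ B ⊆ A * E

/-- `q` matches the cosets of `𝔓` with those of `𝔔` up to a uniform neighbourhood. For finitely
generated groups and a quasi-isometry `q`, this is a quasi-isometry of pairs. -/
def IsCosetMatching (q : G → H) (𝔓 : Set (Subgroup G)) (𝔔 : Set (Subgroup H)) : Prop :=
  ∃ E : Set H, E.Finite ∧
    (∀ A ∈ cosetsOf 𝔓, ∃ B ∈ cosetsOf 𝔔, q '' A ⊆ B * E ∧ B ⊆ q '' A * E) ∧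
    ∀ B ∈ cosetsOf 𝔔, ∃ A ∈ cosetsOf 𝔓, q '' A ⊆ B * E ∧ B ⊆ q '' A * E

/-- Distinct cosets of members of `𝔓` are not close. -/
def IsCoarselySeparated (𝔓 : Set (Subgroup G)) : Prop :=
  ∀ A ∈ cosetsOf 𝔓, ∀ A' ∈ cosetsOf 𝔓, AreClose A A' → A = A'

theorem Set.subset_mul_trans {A B C E F : Set G} (h : A ⊆ B * E) (h' : B ⊆ C * F) :
    A ⊆ C * (F * E) :=
  h.trans ((Set.mul_subset_mul_right h').trans (mul_assoc C F E).subset)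

namespace AreClose

theorem of_subset {A B E F : Set G} (hE : E.Finite) (hF : F.Finite) (h : A ⊆ B * E)
    (h' : B ⊆ A * F) : AreClose A B :=
  ⟨E ∪ F, hE.union hF, h.trans (Set.mul_subset_mul_left Set.subset_union_left),
    h'.trans (Set.mul_subset_mul_left Set.subset_union_right)⟩

theorem symm {A B : Set G} (h : AreClose A B) : AreClose B A := by
  obtain ⟨E, hE, h1, h2⟩ := h
  exact ⟨E, hE, h2, h1⟩

theorem trans {A B C : Set G} (h : AreClose A B) (h' : AreClose B C) : AreClose A C := by
  obtain ⟨E, hE, h1, h2⟩ := h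
  obtain ⟨F, hF, h3, h4⟩ := h'
  exact of_subset (hF.mul hE) (hE.mul hF) (Set.subset_mul_trans h1 h3)
    (Set.subset_mul_trans h4 h2)

theorem smul {A B : Set G} (h : AreClose A B) (g : G) : AreClose (g • A) (g • B) := by
  obtain ⟨E, hE, h1, h2⟩ := h
  refine ⟨E, hE, ?_, ?_⟩ <;> rw [smul_mul_assoc] <;> exact Set.smul_set_mono ‹_›

end AreClose

theorem IsControlled.exists_image_subset {f : G → H} (hf : IsControlled f) {E : Set G}
    (hE : E.Finite) : ∃ E' : Set H, E'.Finite ∧ ∀ A B : Set G, A ⊆ B * E → f '' A ⊆ f '' B * E' := by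
  obtain ⟨E', hE', h⟩ := hf E hE
  refine ⟨E', hE', ?_⟩
  rintro A B hAB _ ⟨a, ha, rfl⟩
  obtain ⟨b, hb, e, he, rfl⟩ := hAB ha
  exact ⟨f b, ⟨b, hb, rfl⟩, _, h b (b * e) (by simpa), by simp⟩

theorem AreClose.image {f : G → H} (hf : IsControlled f) {A B : Set G} (h : AreClose A B) :
    AreClose (f '' A) (f '' B) := by
  obtain ⟨E, hE, h1, h2⟩ := h
  obtain ⟨E', hE', h⟩ := hf.exists_image_subset hE
  exact ⟨E', hE', h _ _ h1, h _ _ h2⟩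

namespace IsCoarseInverse

variable {S : Set G} {T : Set H} {q : G → H} {r : H → G} {𝔓 : Set (Subgroup G)}
  {𝔔 : Set (Subgroup H)}

theorem symm (hc : IsCoarseInverse S T q r) : IsCoarseInverse T S r q :=
  ⟨hc.2, hc.1, hc.4, hc.3, hc.6, hc.5⟩

theorem exists_image_image (hc : IsCoarseInverse S T q r) :
    ∃ E : Set G, E.Finite ∧ ∀ A, r '' (q '' A) ⊆ A * E ∧ A ⊆ r '' (q '' A) * E := by
  obtain ⟨E, hE, h⟩ := hc.left_inv
  refine ⟨E ∪ E⁻¹, hE.union hE.inv, fun A => ⟨?_, fun a ha => ?_⟩⟩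
  · rintro _ ⟨_, ⟨a, ha, rfl⟩, rfl⟩
    exact ⟨a, ha, _, Or.inl (h a), by simp⟩
  · exact ⟨r (q a), ⟨_, ⟨a, ha, rfl⟩, rfl⟩, (r (q a))⁻¹ * a, Or.inr (by simpa using h a), by simp⟩

/-- `q` is expanding: closeness of images gives closeness, with uniform radii. -/
theorem exists_subset_of_image_subset (hc : IsCoarseInverse S T q r) {E : Set H}
    (hE : E.Finite) :
    ∃ F : Set G, F.Finite ∧ ∀ A A' : Set G, q '' A ⊆ q '' A' * E → A ⊆ A' * F := by
  obtain ⟨E₁, hE₁, h₁⟩ := hc.controlled_inv.exists_image_subset hE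
  obtain ⟨E₂, hE₂, h₂⟩ := hc.exists_image_image
  refine ⟨E₂ * (E₁ * E₂), hE₂.mul (hE₁.mul hE₂), fun A A' h => ?_⟩
  exact Set.subset_mul_trans (Set.subset_mul_trans (h₂ A).2 (h₁ _ _ h)) (h₂ A').1

theorem areClose_of_image (hc : IsCoarseInverse S T q r) {A A' : Set G}
    (h : AreClose (q '' A) (q '' A')) : AreClose A A' := by
  obtain ⟨E, hE, h1, h2⟩ := h
  obtain ⟨F, hF, h⟩ := hc.exists_subset_of_image_subset hE
  exact ⟨F, hF, h _ _ h1, h _ _ h2⟩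

theorem finite_preimage (hc : IsCoarseInverse S T q r) {F : Set H} (hF : F.Finite) :
    (q ⁻¹' F).Finite := by
  obtain ⟨E, hE, h⟩ := hc.exists_image_image
  refine (((hF.image r).mul hE)).subset ((h _).2.trans (Set.mul_subset_mul_right ?_))
  exact Set.image_mono (Set.image_preimage_subset q F)

theorem isCosetMatching_symm (hc : IsCoarseInverse S T q r) (hm : IsCosetMatching q 𝔓 𝔔) :
    IsCosetMatching r 𝔔 𝔓 := by
  obtain ⟨E, hE, hm1, hm2⟩ := hm
  obtain ⟨E₁, hE₁, h₁⟩ := hc.controlled_inv.exists_image_subset hE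
  obtain ⟨E₂, hE₂, h₂⟩ := hc.exists_image_image
  have key : ∀ A B, q '' A ⊆ B * E ∧ B ⊆ q '' A * E →
      r '' B ⊆ A * (E₂ * E₁ ∪ E₁ * E₂) ∧ A ⊆ r '' B * (E₂ * E₁ ∪ E₁ * E₂) := by
    rintro A B ⟨h, h'⟩
    exact ⟨(Set.subset_mul_trans (h₁ _ _ h') (h₂ A).1).trans
        (Set.mul_subset_mul_left Set.subset_union_left),
      (Set.subset_mul_trans (h₂ A).2 (h₁ _ _ h)).trans
        (Set.mul_subset_mul_left Set.subset_union_right)⟩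
  refine ⟨_, (hE₂.mul hE₁).union (hE₁.mul hE₂), fun B hB => ?_, fun A hA => ?_⟩
  · obtain ⟨A, hA, h⟩ := hm2 B hB
    exact ⟨A, hA, key A B h⟩
  · obtain ⟨B, hB, h⟩ := hm1 A hA
    exact ⟨B, hB, key A B h⟩

/-- The coarse equivalence `q` induces Lipschitz maps on the relative Cayley graphs, since edges in
cosets of `𝔓` go to pairs of points close to a coset of `𝔔`. -/
theorem exists_relCayleyGraph_dist_le (hc : IsCoarseInverse S T q r)
    (hT : Subgroup.closure T = ⊤) (hm : IsCosetMatching q 𝔓 𝔔) :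
    ∃ K : ℕ, ∀ x x', (relCayleyGraph S 𝔓).Adj x x' →
      (relCayleyGraph T 𝔔).dist (q x) (q x') ≤ K := by
  obtain ⟨K, hK⟩ := hc.lipschitz
  obtain ⟨E, hE, hm1, -⟩ := hm
  obtain ⟨N, hN⟩ := exists_mulCayley_dist_le hT hE
  refine ⟨K + 2 * N + 1, fun x x' hadj => ?_⟩
  have hle := relCayleyGraph_dist_le hT 𝔔
  rcases relCayleyGraph_adj_iff.1 hadj with h | ⟨-, A, hA, hx, hx'⟩
  · have := (hle _ _).trans (hK _ _ h)
    omega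
  · obtain ⟨B, hB, hAB, -⟩ := hm1 A hA
    obtain ⟨b, hb, e, he, hbe⟩ := hAB ⟨x, hx, rfl⟩
    obtain ⟨b', hb', e', he', hbe'⟩ := hAB ⟨x', hx', rfl⟩
    have h1 := (hle b (q x)).trans (hN _ _ (by simpa [← hbe] using he))
    have h2 := (hle b' (q x')).trans (hN _ _ (by simpa [← hbe'] using he'))
    have h3 := relCayleyGraph_dist_le_one (X := T) hB hb hb'
    have hconn := relCayleyGraph_connected hT 𝔔
    have h4 := hconn.dist_triangle (u := q x) (v := b) (w := q x')
    have h5 := hconn.dist_triangle (u := b) (v := b') (w := q x')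
    rw [dist_comm] at h1
    omega

/-- Relative metrics of `𝔓` are locally finite if those of `𝔔` are. Matched cosets of distinct
cosets are distinct, so `q` sends a path that avoids the edges inside a coset to a path that avoids
the edges inside the matched coset. -/
theorem finite_relMetric_ball (hc : IsCoarseInverse S T q r) (hT : Subgroup.closure T = ⊤)
    (hm : IsCosetMatching q 𝔓 𝔔) (hsep : IsCoarselySeparated 𝔓)
    (hfin : ∀ Q ∈ 𝔔, ∀ g ∈ Q, ∀ n : ℕ, {h : H | h ∈ Q ∧ relMetric T 𝔔 Q g h ≤ n}.Finite)
    {P : Subgroup G} (hP : P ∈ 𝔓) {g : G} (hg : g ∈ P) (n : ℕ) :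
    {h : G | h ∈ P ∧ relMetric S 𝔓 P g h ≤ n}.Finite := by
  obtain ⟨K, hK⟩ := hc.lipschitz
  obtain ⟨E, hE, hm1, -⟩ := hm
  obtain ⟨N, hN⟩ := exists_mulCayley_dist_le hT hE
  choose! φ hφ hφ1 hφ2 using hm1
  have hinj : ∀ A ∈ cosetsOf 𝔓, ∀ A' ∈ cosetsOf 𝔓, φ A = φ A' → A = A' := by
    intro A hA A' hA' h
    have h1 : AreClose (q '' A) (φ A) := ⟨E, hE, hφ1 A hA, hφ2 A hA⟩
    have h2 : AreClose (q '' A') (φ A') := ⟨E, hE, hφ1 A' hA', hφ2 A' hA'⟩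
    exact hsep A hA A' hA' (hc.areClose_of_image (h1.trans (h ▸ h2.symm)))
  have hPc := coe_mem_cosetsOf hP
  obtain ⟨b, Q, hQ, hbQ⟩ := hφ _ hPc
  -- After a translation the coset matched with `P` is the subgroup `Q`.
  have hadj : ∀ x y, (admissibleGraph S 𝔓 P).Adj x y →
      (admissibleGraph T 𝔔 Q).edist (b⁻¹ * q x) (b⁻¹ * q y) ≤ (K + (2 * N + 1) : ℕ) := by
    intro x y hxy
    rcases admissibleGraph_adj_iff.1 hxy with h | ⟨-, A, hA, hne, hx, hy⟩
    · refine (admissibleGraph_edist_le hT 𝔔 Q _ _).trans (Nat.cast_le.2 ?_)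
      rw [mulCayley_dist_mul_left hT]
      exact (hK _ _ h).trans (Nat.le_add_right _ _)
    · have hmem : ∀ z ∈ A, b⁻¹ * q z ∈ (b⁻¹ • φ A) * E := by
        intro z hz
        rw [smul_mul_assoc]
        exact Set.smul_mem_smul_set (hφ1 A hA ⟨z, hz, rfl⟩)
      refine (admissibleGraph_edist_le_of_mem_mul hT (smul_mem_cosetsOf (hφ A hA) b⁻¹) ?_ hN
        (hmem x hx) (hmem y hy)).trans (Nat.cast_le.2 (Nat.le_add_left _ _))
      intro h
      rw [inv_smul_eq_iff, ← hbQ] at h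
      exact hne (hinj A hA _ hPc h)
  have hnear : ∀ x ∈ P, ∃ β ∈ Q, ∃ e ∈ E, q x = b * β * e := by
    intro x hx
    obtain ⟨_, hβ, e, he, h⟩ := hφ1 _ hPc ⟨x, hx, rfl⟩
    rw [hbQ] at hβ
    obtain ⟨β, hβ, rfl⟩ := hβ
    exact ⟨β, hβ, e, he, h.symm⟩
  obtain ⟨β, hβ, e, he, hge⟩ := hnear g hg
  have hfin' := hfin Q hQ β hβ (N + ((K + (2 * N + 1)) * n + N))
  refine (hc.finite_preimage (((Set.finite_singleton b).mul hfin').mul hE)).subset ?_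
  rintro x ⟨hx, hgx⟩
  obtain ⟨β', hβ', e', he', hxe⟩ := hnear x hx
  refine ⟨b * β', ⟨b, rfl, β', ⟨hβ', ?_⟩, rfl⟩, e', he', hxe.symm⟩
  have h1 := edist_map_le hadj hgx
  rw [hge, hxe] at h1
  simp only [mul_assoc, inv_mul_cancel_left] at h1
  have hclose : ∀ γ : H, ∀ e ∈ E, (admissibleGraph T 𝔔 Q).edist γ (γ * e) ≤ N := fun γ e he =>
    (admissibleGraph_edist_le hT 𝔔 Q _ _).trans (Nat.cast_le.2 (hN _ _ (by simpa)))
  have h2 := hclose β e he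
  have h3 := hclose β' e' he'
  rw [SimpleGraph.edist_comm] at h3
  rw [relMetric]
  push_cast at h1 ⊢
  exact SimpleGraph.edist_triangle.trans
    (add_le_add h2 (SimpleGraph.edist_triangle.trans (add_le_add h1 h3)))

/-- Hyperbolic embeddedness is pulled back by a coarse equivalence that matches cosets. -/
theorem hypEmbedded (hc : IsCoarseInverse S T q r) (hS : Subgroup.closure S = ⊤)
    (hT : Subgroup.closure T = ⊤) (hm : IsCosetMatching q 𝔓 𝔔) (hsep : IsCoarselySeparated 𝔓)
    (h : HypEmbedded 𝔔 T) : HypEmbedded 𝔓 S := by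
  refine ⟨top_le_iff.1 (hS ▸ Subgroup.closure_mono Set.subset_union_left), ?_,
    fun P hP g hg n => hc.finite_relMetric_ball hT hm hsep h.2.2 hP hg n⟩
  obtain ⟨K₁, hK₁⟩ := hc.exists_relCayleyGraph_dist_le hT hm
  obtain ⟨K₂, hK₂⟩ := hc.symm.exists_relCayleyGraph_dist_le hS (hc.isCosetMatching_symm hm)
  obtain ⟨E, hE, hrq⟩ := hc.left_inv
  obtain ⟨N, hN⟩ := exists_mulCayley_dist_le hS hE
  refine (relCayleyGraph_connected hS 𝔓).isHyperbolicGraph_of_retract h.2.1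
    (f := q) (r := r) (K := K₁ + K₂ + N) (fun x x' hx => (hK₁ x x' hx).trans (by omega))
    (fun y y' hy => (hK₂ y y' hy).trans (by omega)) (fun x => ?_)
  rw [dist_comm]
  exact ((relCayleyGraph_dist_le hS 𝔓 _ _).trans (hN _ _ (hrq x))).trans (by omega)

end IsCoarseInverse

/-- Infinite hyperbolically embedded subgroups have coarsely separated cosets: if `gQ` is another
coset close to `P`, then detours through `gQ` give a bound on the relative metric of `P`. -/
theorem HypEmbedded.isCoarselySeparated {𝔔 : Set (Subgroup H)} {T : Set H}
    (h : HypEmbedded 𝔔 T) (hT : Subgroup.closure T = ⊤)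
    (hinf : ∀ Q ∈ 𝔔, (Q : Set H).Infinite) : IsCoarselySeparated 𝔔 := by
  rintro _ ⟨g, Q, hQ, rfl⟩ A hA hclose
  by_contra hne
  obtain ⟨E, hE, hsub, -⟩ := hclose.smul g⁻¹
  rw [inv_smul_smul] at hsub
  obtain ⟨N, hN⟩ := exists_mulCayley_dist_le hT hE
  refine hinf Q hQ ((h.2.2 Q hQ 1 Q.one_mem (2 * N + 1)).subset fun x hx => ⟨hx, ?_⟩)
  refine admissibleGraph_edist_le_of_mem_mul hT (smul_mem_cosetsOf hA g⁻¹) ?_ hN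
    (hsub Q.one_mem) (hsub hx)
  intro heq
  rw [inv_smul_eq_iff] at heq
  exact hne heq.symm

end Coarse

/-! ### Commensurability and closeness of cosets -/

section Commensurable

open Subgroup

variable {G H : Type*} [Group G] [Group H]

theorem Subgroup.relIndex_ne_zero_iff_exists_finite_mul {K P : Subgroup G} :
    K.relIndex P ≠ 0 ↔ ∃ E : Set G, E.Finite ∧ (P : Set G) ⊆ (K : Set G) * E := by
  have hiff : ∀ {x y : P}, (QuotientGroup.mk x : P ⧸ K.subgroupOf P) = QuotientGroup.mk y ↔
      (x : G)⁻¹ * y ∈ K := by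
    intro x y
    rw [QuotientGroup.eq, mem_subgroupOf]
    rfl
  constructor
  · intro h
    have : (K.subgroupOf P).FiniteIndex := ⟨h⟩
    refine ⟨Set.range fun x : P ⧸ K.subgroupOf P => ((x.out : P) : G)⁻¹, Set.finite_range _,
      fun p hp => ?_⟩
    let c : P ⧸ K.subgroupOf P := QuotientGroup.mk ⟨p⁻¹, P.inv_mem hp⟩
    have hc : ((⟨p⁻¹, P.inv_mem hp⟩ : P) : G)⁻¹ * (c.out : P) ∈ K :=
      hiff.1 (QuotientGroup.out_eq' c).symm
    exact ⟨p * (c.out : P), by simpa using hc, _, ⟨c, rfl⟩, by simp⟩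
  · rintro ⟨E, hE, h⟩
    have hex : ∀ x : P, ∃ e ∈ E, ∃ k ∈ K, (x : G)⁻¹ = k * e := by
      intro x
      obtain ⟨k, hk, e, he, hx⟩ := h (P.inv_mem x.2)
      exact ⟨e, he, k, hk, hx.symm⟩
    choose ε hε κ hκ hx using hex
    have := hE.to_subtype
    have hfin : Finite (P ⧸ K.subgroupOf P) := by
      refine Finite.of_injective
        (fun c : P ⧸ K.subgroupOf P => (⟨ε c.out, hε _⟩ : E)) fun c d hcd => ?_
      have hcd' : ε c.out = ε d.out := congrArg Subtype.val hcd
      rw [← QuotientGroup.out_eq' c, ← QuotientGroup.out_eq' d, hiff]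
      have hd : ((d.out : P) : G) = (ε d.out)⁻¹ * (κ d.out)⁻¹ := by
        rw [← mul_inv_rev, ← hx, inv_inv]
      rw [hx, hd, hcd']
      simpa [mul_assoc] using K.mul_mem (hκ c.out) (K.inv_mem (hκ d.out))
    exact index_ne_zero_of_finite

theorem Subgroup.commensurable_iff_areClose {P Q : Subgroup G} :
    Commensurable P Q ↔ AreClose (P : Set G) (Q : Set G) := by
  rw [Commensurable, relIndex_ne_zero_iff_exists_finite_mul,
    relIndex_ne_zero_iff_exists_finite_mul]
  constructor
  · rintro ⟨⟨E, hE, h⟩, ⟨F, hF, h'⟩⟩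
    exact AreClose.of_subset hF hE h' h
  · rintro ⟨E, hE, h, h'⟩
    exact ⟨⟨E, hE, h'⟩, ⟨E, hE, h⟩⟩

/-- A coset `gQ` is close to the conjugate `gQg⁻¹`. -/
theorem areClose_conj_smul (Q : Subgroup G) (g : G) :
    AreClose ((ConjAct.toConjAct g • Q : Subgroup G) : Set G) (g • (Q : Set G)) := by
  refine AreClose.of_subset (Set.finite_singleton g⁻¹) (Set.finite_singleton g) ?_ ?_
  · intro x hx
    obtain ⟨y, hy, rfl⟩ := (Subgroup.mem_smul_pointwise_iff_exists _ _ _).1 hx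
    exact ⟨g * y, ⟨y, hy, rfl⟩, g⁻¹, rfl, by simp [ConjAct.smul_def]⟩
  · rintro _ ⟨y, hy, rfl⟩
    refine ⟨ConjAct.toConjAct g • y, Subgroup.smul_mem_pointwise_smul _ _ _ hy, g, rfl, ?_⟩
    simp [ConjAct.smul_def]

/-- Close cosets have commensurable stabilizers. -/
theorem areClose_smul_iff {P Q : Subgroup G} {g g' : G} :
    AreClose (g • (P : Set G)) (g' • (Q : Set G)) ↔
      Commensurable P (ConjAct.toConjAct (g⁻¹ * g') • Q) := by
  rw [commensurable_iff_areClose]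
  have hconj := areClose_conj_smul Q (g⁻¹ * g')
  constructor
  · intro h
    have h' := h.smul g⁻¹
    rw [inv_smul_smul, smul_smul] at h'
    exact h'.trans hconj.symm
  · intro h
    have h' := (h.trans hconj).smul g
    rwa [smul_smul, mul_inv_cancel_left] at h'

theorem smul_coe_eq_of_inv_mul_mem {P : Subgroup G} {g g' : G} (h : g⁻¹ * g' ∈ P) :
    g • (P : Set G) = g' • (P : Set G) := by
  conv_lhs => rw [← smul_coe_set h, smul_smul, mul_inv_cancel_left]

theorem IsReducedCollection.isCoarselySeparated {𝔓 : Set (Subgroup G)}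
    (h : IsReducedCollection 𝔓) : IsCoarselySeparated 𝔓 := by
  rintro _ ⟨g, P, hP, rfl⟩ _ ⟨g', Q, hQ, rfl⟩ hclose
  obtain ⟨rfl, hg⟩ := h P hP Q hQ _ (areClose_smul_iff.1 hclose)
  exact smul_coe_eq_of_inv_mul_mem hg

theorem Subgroup.Commensurable.commensurator_conj (K : Subgroup G) (g : G) :
    commensurator (ConjAct.toConjAct g • K) = ConjAct.toConjAct g • commensurator K := by
  ext x
  rw [Subgroup.mem_pointwise_smul_iff_inv_smul_mem, commensurator_mem_iff, commensurator_mem_iff,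
    commensurable_conj (ConjAct.toConjAct g)⁻¹, inv_smul_smul, smul_smul, smul_smul]
  have : ConjAct.toConjAct ((ConjAct.toConjAct g)⁻¹ • x) =
      (ConjAct.toConjAct g)⁻¹ * (ConjAct.toConjAct x * ConjAct.toConjAct g) := by
    rw [ConjAct.smul_def]
    simp [mul_assoc]
  rw [this, mul_assoc]

theorem Subgroup.Commensurable.le_commensurator (K : Subgroup G) : K ≤ commensurator K := by
  intro x hx
  have h : ConjAct.toConjAct x • K = K := Subgroup.conj_smul_eq_self_of_mem hx
  rw [commensurator_mem_iff, h]

/-! ### Refinements -/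

variable {S : Set G} {T : Set H} {q : G → H} {r : H → G} {𝔓 ℛ : Set (Subgroup G)}
  {𝔔 : Set (Subgroup H)}

/-- If the cosets of `𝔔` are coarsely separated, then close cosets of `𝔓` are matched with the same
coset, hence are uniformly close. -/
theorem IsCoarseInverse.exists_uniform_subset (hc : IsCoarseInverse S T q r)
    (hm : IsCosetMatching q 𝔓 𝔔) (hsep : IsCoarselySeparated 𝔔) :
    ∃ F : Set G, F.Finite ∧ ∀ A ∈ cosetsOf 𝔓, ∀ A' ∈ cosetsOf 𝔓, AreClose A A' →
      A ⊆ A' * F := by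
  obtain ⟨E, hE, hm1, -⟩ := hm
  obtain ⟨F, hF, h⟩ := hc.exists_subset_of_image_subset (hE.mul hE)
  refine ⟨F, hF, fun A hA A' hA' hclose => h A A' ?_⟩
  obtain ⟨B, hB, h1, h2⟩ := hm1 A hA
  obtain ⟨B', hB', h1', h2'⟩ := hm1 A' hA'
  have hBB' : B = B' := by
    have hA1 : AreClose (q '' A) B := ⟨E, hE, h1, h2⟩
    have hA2 : AreClose (q '' A') B' := ⟨E, hE, h1', h2'⟩
    exact hsep B hB B' hB' (hA1.symm.trans ((hclose.image hc.controlled).trans hA2))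
  exact Set.subset_mul_trans h1 (hBB' ▸ h2')

/-- Uniform closeness of commensurable translates makes `gPg⁻¹` of finite index in its
commensurator. -/
theorem IsCoarseInverse.commensurable_commensurator (hc : IsCoarseInverse S T q r)
    (hm : IsCosetMatching q 𝔓 𝔔) (hsep : IsCoarselySeparated 𝔔) {P : Subgroup G} (hP : P ∈ 𝔓)
    (g : G) : Commensurable (ConjAct.toConjAct g • P)
      (Commensurable.commensurator (ConjAct.toConjAct g • P)) := by
  suffices h : Commensurable P (Commensurable.commensurator P) by
    rw [Commensurable.commensurator_conj]
    exact h.conj _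
  obtain ⟨F, hF, h⟩ := hc.exists_uniform_subset hm hsep
  rw [commensurable_iff_areClose]
  refine AreClose.of_subset (Set.finite_singleton 1) hF
    (fun x hx => ⟨x, Commensurable.le_commensurator P hx, 1, rfl, mul_one x⟩) fun x hx => ?_
  have hclose : AreClose (x • (P : Set G)) (P : Set G) := by
    have h1 := commensurable_iff_areClose.1 ((Commensurable.commensurator_mem_iff P x).1 hx)
    exact (areClose_conj_smul P x).symm.trans h1
  exact h _ (smul_mem_cosetsOf (coe_mem_cosetsOf hP) x) _ (coe_mem_cosetsOf hP) hclose
    ⟨1, P.one_mem, by simp⟩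

theorem IsRefinement.eq_of_conj (hR : IsRefinement 𝔓 ℛ) {R R' : Subgroup G} (h : R ∈ ℛ)
    (h' : R' ∈ ℛ) {g : G} (hg : R = ConjAct.toConjAct g • R') : R = R' :=
  (hR.2 R' (hR.1 h')).unique ⟨h, g, hg⟩ ⟨h', 1, by simp⟩

theorem IsRefinement.finite (hR : IsRefinement 𝔓 ℛ) (h𝔓 : 𝔓.Finite) : ℛ.Finite := by
  have hex : ∀ R ∈ ℛ, ∃ P ∈ 𝔓, ∃ g : G,
      R = Commensurable.commensurator (ConjAct.toConjAct g • P) := fun R h => hR.1 h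
  choose! p hp g hg using hex
  refine Set.Finite.of_injOn (f := p) (fun R h => hp R h) (fun R h R' h' heq => ?_) h𝔓
  refine hR.eq_of_conj h h' (g := g R * (g R')⁻¹) ?_
  have h1 := hg R h
  have h2 := hg R' h'
  rw [Commensurable.commensurator_conj] at h1 h2
  rw [ConjAct.toConjAct_mul, ConjAct.toConjAct_inv, mul_smul, ← eq_inv_smul_iff.2 h2.symm, ← heq]
  exact h1

/-- Members of a refinement are their own commensurators and pairwise non-conjugate, so their cosets
are coarsely separated. -/
theorem IsCoarseInverse.isCoarselySeparated_of_isRefinement (hc : IsCoarseInverse S T q r)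
    (hm : IsCosetMatching q 𝔓 𝔔) (hsep : IsCoarselySeparated 𝔔) (hR : IsRefinement 𝔓 ℛ) :
    IsCoarselySeparated ℛ := by
  have hself : ∀ R ∈ ℛ, Commensurable.commensurator R = R := by
    intro R h
    obtain ⟨P, hP, g, rfl⟩ := hR.1 h
    exact (hc.commensurable_commensurator hm hsep hP g).eq.symm
  rintro _ ⟨g, R, h, rfl⟩ _ ⟨g', R', h', rfl⟩ hclose
  have heq := (areClose_smul_iff.1 hclose).eq
  rw [Commensurable.commensurator_conj, hself R h, hself R' h'] at heq
  obtain rfl := hR.eq_of_conj h h' heq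
  refine smul_coe_eq_of_inv_mul_mem ?_
  rw [← hself R h, Commensurable.commensurator_mem_iff, ← heq]

/-- A matching of cosets passes to refinements: a coset of a refinement is uniformly close to a
coset of the original collection. -/
theorem IsCoarseInverse.isCosetMatching_of_isRefinement (hc : IsCoarseInverse S T q r)
    (hm : IsCosetMatching q 𝔓 𝔔) (hsep : IsCoarselySeparated 𝔔) (hR : IsRefinement 𝔓 ℛ)
    (h𝔓 : 𝔓.Finite) : IsCosetMatching q ℛ 𝔔 := by
  have hcosets : ∀ P ∈ 𝔓, ∀ g : G, AreClose (g • (P : Set G))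
      (Commensurable.commensurator (ConjAct.toConjAct g • P) : Set G) := fun P hP g =>
    (areClose_conj_smul P g).symm.trans
      (commensurable_iff_areClose.1 (hc.commensurable_commensurator hm hsep hP g))
  have hunif : ∃ F : Set G, F.Finite ∧ ∀ C ∈ cosetsOf ℛ, ∃ A ∈ cosetsOf 𝔓,
      A ⊆ C * F ∧ C ⊆ A * F := by
    have hex : ∀ R ∈ ℛ, ∃ A ∈ cosetsOf 𝔓, AreClose A (R : Set G) := by
      intro R h
      obtain ⟨P, hP, g, rfl⟩ := hR.1 h
      exact ⟨g • (P : Set G), ⟨g, P, hP, rfl⟩, hcosets P hP g⟩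
    choose! A hA E hE hE1 hE2 using hex
    refine ⟨⋃ R ∈ ℛ, E R, (hR.finite h𝔓).biUnion hE, ?_⟩
    rintro _ ⟨x, R, h, rfl⟩
    have hsub : E R ⊆ ⋃ R ∈ ℛ, E R := Set.subset_biUnion_of_mem h
    refine ⟨x • A R, smul_mem_cosetsOf (hA R h) x, ?_, ?_⟩
    · rw [smul_mul_assoc]
      exact Set.smul_set_mono ((hE1 R h).trans (Set.mul_subset_mul_left hsub))
    · rw [smul_mul_assoc]
      exact Set.smul_set_mono ((hE2 R h).trans (Set.mul_subset_mul_left hsub))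
  have hall : ∀ A ∈ cosetsOf 𝔓, ∃ C ∈ cosetsOf ℛ, AreClose A C := by
    rintro _ ⟨y, P, hP, rfl⟩
    obtain ⟨R, ⟨hRm, k, hk⟩, -⟩ := hR.2 _ ⟨P, hP, y, rfl⟩
    refine ⟨k⁻¹ • (R : Set G), ⟨k⁻¹, R, hRm, rfl⟩, ?_⟩
    have h1 := (hcosets P hP (k * y)).smul k⁻¹
    rwa [smul_smul, inv_mul_cancel_left, ConjAct.toConjAct_mul, ← smul_smul,
      Commensurable.commensurator_conj, ← hk] at h1
  obtain ⟨F, hF, hunif⟩ := hunif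
  obtain ⟨F₁, hF₁, hclose⟩ := hc.exists_uniform_subset hm hsep
  obtain ⟨E₁, hE₁, hq₁⟩ := hc.controlled.exists_image_subset hF
  obtain ⟨E₂, hE₂, hq₂⟩ := hc.controlled.exists_image_subset (hF₁.mul hF)
  obtain ⟨E₃, hE₃, hq₃⟩ := hc.controlled.exists_image_subset (hF.mul hF₁)
  obtain ⟨E, hE, hm1, hm2⟩ := hm
  have hle : ∀ {A B C D D' : Set H}, A ⊆ B * C → C ⊆ D → D ⊆ D' → A ⊆ B * D' :=
    fun h h1 h2 => h.trans (Set.mul_subset_mul_left (h1.trans h2))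
  refine ⟨(E * E₁ ∪ E₁ * E) ∪ (E * E₂ ∪ E₃ * E), ((hE.mul hE₁).union (hE₁.mul hE)).union
    ((hE.mul hE₂).union (hE₃.mul hE)), fun C hC => ?_, fun B hB => ?_⟩
  · obtain ⟨A, hA, h1, h2⟩ := hunif C hC
    obtain ⟨B, hB, h3, h4⟩ := hm1 A hA
    exact ⟨B, hB, hle (Set.subset_mul_trans (hq₁ _ _ h2) h3) Set.subset_union_left
        Set.subset_union_left,
      hle (Set.subset_mul_trans h4 (hq₁ _ _ h1)) Set.subset_union_right Set.subset_union_left⟩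
  · obtain ⟨A, hA, h3, h4⟩ := hm2 B hB
    obtain ⟨C, hC, hAC⟩ := hall A hA
    obtain ⟨A', hA', h1, h2⟩ := hunif C hC
    -- `C` is close to `A`, possibly with a large radius, and uniformly close to `A'`; as `A` and
    -- `A'` are close to each other, they are uniformly close.
    have hAA' : AreClose A A' := hAC.trans ⟨F, hF, h2, h1⟩
    have h5 := Set.subset_mul_trans (hclose A hA A' hA' hAA') h1
    have h6 := Set.subset_mul_trans h2 (hclose A' hA' A hA hAA'.symm)
    exact ⟨C, hC, hle (Set.subset_mul_trans (hq₂ _ _ h6) h3) Set.subset_union_left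
        Set.subset_union_right,
      hle (Set.subset_mul_trans h4 (hq₃ _ _ h5)) Set.subset_union_right Set.subset_union_right⟩

end Commensurable

/-! ### Quasi-isometries as coarse equivalences -/

theorem IsQuasiIsometry.exists_nat_bounds {X Y : Type*} {Γ : SimpleGraph X} {Δ : SimpleGraph Y}
    {f : X → Y} (hf : IsQuasiIsometry Γ Δ f) :
    ∃ K : ℕ, (∀ x x', Δ.dist (f x) (f x') ≤ K * Γ.dist x x' + K) ∧
      (∀ x x', Γ.dist x x' ≤ K * Δ.dist (f x) (f x') + K) ∧ ∀ y, ∃ x, Δ.dist (f x) y ≤ K := by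
  obtain ⟨L, C, hL, hC, hd, hs⟩ := hf
  have hK : L * (1 + C) ≤ ⌈L * (1 + C)⌉₊ := Nat.le_ceil _
  have hLK : L ≤ ⌈L * (1 + C)⌉₊ := by nlinarith
  have hLCK : L * C ≤ ⌈L * (1 + C)⌉₊ := by nlinarith
  have hCK : C ≤ ⌈L * (1 + C)⌉₊ := by nlinarith
  generalize ⌈L * (1 + C)⌉₊ = K at *
  refine ⟨K, fun x x' => ?_, fun x x' => ?_, fun y => ?_⟩
  · have h1 := (hd x x').2
    have h2 := mul_le_mul_of_nonneg_right hLK (Nat.cast_nonneg (α := ℝ) (Γ.dist x x'))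
    have h3 : (Δ.dist (f x) (f x') : ℝ) ≤ K * Γ.dist x x' + K := by linarith
    exact_mod_cast h3
  · have h1 : L⁻¹ * (Γ.dist x x' : ℝ) ≤ Δ.dist (f x) (f x') + C := by linarith [(hd x x').1]
    rw [inv_mul_le_iff₀ (by linarith)] at h1
    have h2 := mul_le_mul_of_nonneg_right hLK (Nat.cast_nonneg (α := ℝ) (Δ.dist (f x) (f x')))
    have h3 : (Γ.dist x x' : ℝ) ≤ K * Δ.dist (f x) (f x') + K := by linarith
    exact_mod_cast h3
  · obtain ⟨x, hx⟩ := hs y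
    have h3 : (Δ.dist (f x) y : ℝ) ≤ K := hx.trans hCK
    exact ⟨x, by exact_mod_cast h3⟩

section QuasiIsometry

open SimpleGraph

variable {G H : Type*} [Group G] [Group H] {S₀ S : Set G} {T₀ T : Set H} {q : G → H}

/-- A quasi-isometry for word metrics of finite generating sets, which is also one for the word
metrics of `S` and `T`, has a coarse inverse that is Lipschitz for `S` and `T`. -/
theorem exists_isCoarseInverse (hS₀fin : S₀.Finite) (hS₀ : Subgroup.closure S₀ = ⊤)
    (hT₀fin : T₀.Finite) (hT₀ : Subgroup.closure T₀ = ⊤)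
    (hT : Subgroup.closure T = ⊤)
    (hq₀ : IsQuasiIsometry (mulCayley S₀) (mulCayley T₀) q)
    (hq : IsQuasiIsometry (mulCayley S) (mulCayley T) q) :
    ∃ r : H → G, IsCoarseInverse S T q r := by
  obtain ⟨K₀, hup₀, hlow₀, hsurj⟩ := hq₀.exists_nat_bounds
  obtain ⟨K, hup, hlow, -⟩ := hq.exists_nat_bounds
  choose r hr using hsurj
  have hcG := mulCayley_connected hS₀
  have hcH := mulCayley_connected hT₀
  have hcT := mulCayley_connected hT
  obtain ⟨F, hF, hFball⟩ := exists_finite_of_mulCayley_dist_le hT₀fin hT₀ K₀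
  obtain ⟨M, hM⟩ := exists_mulCayley_dist_le hT hF
  have hrT : ∀ y, (mulCayley T).dist (q (r y)) y ≤ M := fun y => hM _ _ (hFball _ _ (hr y))
  refine ⟨r, fun E hE => ?_, fun E hE => ?_, ?_, ?_, ⟨K * 1 + K, fun x x' h => ?_⟩,
    ⟨K * (2 * M + 1) + K, fun y y' h => ?_⟩⟩
  · obtain ⟨N, hN⟩ := exists_mulCayley_dist_le hS₀ hE
    obtain ⟨E', hE', h⟩ := exists_finite_of_mulCayley_dist_le hT₀fin hT₀ (K₀ * N + K₀)
    refine ⟨E', hE', fun x y hxy => h _ _ ((hup₀ x y).trans ?_)⟩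
    exact Nat.add_le_add_right (Nat.mul_le_mul_left _ (hN x y hxy)) _
  · obtain ⟨N, hN⟩ := exists_mulCayley_dist_le hT₀ hE
    obtain ⟨E', hE', h⟩ :=
      exists_finite_of_mulCayley_dist_le hS₀fin hS₀ (K₀ * (2 * K₀ + N) + K₀)
    refine ⟨E', hE', fun x y hxy => h _ _ ((hlow₀ _ _).trans ?_)⟩
    refine Nat.add_le_add_right (Nat.mul_le_mul_left _ ?_) _
    have h1 := hcH.dist_triangle (u := q (r x)) (v := x) (w := q (r y))
    have h2 := hcH.dist_triangle (u := x) (v := y) (w := q (r y))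
    have h3 := hr x
    have h4 := hr y
    rw [dist_comm] at h4
    have h5 := hN x y hxy
    omega
  · obtain ⟨E', hE', h⟩ := exists_finite_of_mulCayley_dist_le hS₀fin hS₀ (K₀ * K₀ + K₀)
    refine ⟨E', hE', fun x => h _ _ ((hlow₀ _ _).trans ?_)⟩
    rw [dist_comm]
    exact Nat.add_le_add_right (Nat.mul_le_mul_left _ (hr _)) _
  · refine ⟨F, hF, fun y => hFball _ _ ?_⟩
    rw [dist_comm]
    exact hr y
  · exact (hup x x').trans
      (Nat.add_le_add_right (Nat.mul_le_mul_left _ (dist_eq_one_iff_adj.2 h).le) _)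
  · refine (hlow _ _).trans (Nat.add_le_add_right (Nat.mul_le_mul_left _ ?_) _)
    have h1 := hcT.dist_triangle (u := q (r y)) (v := y) (w := q (r y'))
    have h2 := hcT.dist_triangle (u := y) (v := y') (w := q (r y'))
    have h3 := hrT y
    have h4 := hrT y'
    rw [dist_comm] at h4
    have h5 := (dist_eq_one_iff_adj.2 h).le
    omega

theorem IsQuasiIsometryOfPairs.isCosetMatching {𝔓 : Set (Subgroup G)} {𝔔 : Set (Subgroup H)}
    (hT₀fin : T₀.Finite) (hT₀ : Subgroup.closure T₀ = ⊤)
    (h : IsQuasiIsometryOfPairs S₀ T₀ 𝔓 𝔔 q) : IsCosetMatching q 𝔓 𝔔 := by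
  obtain ⟨-, M, -, h1, h2⟩ := h
  obtain ⟨F, hF, hball⟩ := exists_finite_of_mulCayley_dist_le hT₀fin hT₀ ⌊M⌋₊
  have key : ∀ A B, HausdorffDistLT (mulCayley T₀) (q '' A) B M →
      q '' A ⊆ B * F ∧ B ⊆ q '' A * F := by
    rintro A B ⟨ρ, -, hρ, hl, hr⟩
    refine ⟨fun a ha => ?_, fun b hb => ?_⟩
    · obtain ⟨b, hb, hd⟩ := hl a ha
      refine ⟨b, hb, _, hball b a ?_, by simp⟩
      rw [dist_comm]
      exact Nat.le_floor (hd.trans hρ.le)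
    · obtain ⟨a, ha, hd⟩ := hr b hb
      exact ⟨a, ha, _, hball a b (Nat.le_floor (hd.trans hρ.le)), by simp⟩
  refine ⟨F, hF, fun A hA => ?_, fun B hB => ?_⟩
  · obtain ⟨B, hB, h⟩ := h1 A hA
    exact ⟨B, hB, key A B h⟩
  · obtain ⟨A, hA, h⟩ := h2 B hB
    exact ⟨A, hA, key A B h⟩

end QuasiIsometry

/-! ### Quasi-isometry invariance -/

theorem theoremA {G H : Type*} [Group G] [Group H]
    (S₀ : Set G) (hS₀fin : S₀.Finite) (hS₀ : Subgroup.closure S₀ = ⊤)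
    (T₀ : Set H) (hT₀fin : T₀.Finite) (hT₀ : Subgroup.closure T₀ = ⊤)
    (𝔓 : Set (Subgroup G)) (h𝔓 : 𝔓.Finite) (𝔔 : Set (Subgroup H)) (h𝔔 : 𝔔.Finite)
    (S : Set G) (hS : Subgroup.closure S = ⊤) (T : Set H) (hT : Subgroup.closure T = ⊤)
    (q : G → H) (hpairs : IsQuasiIsometryOfPairs S₀ T₀ 𝔓 𝔔 q)
    (hq : IsQuasiIsometry (SimpleGraph.mulCayley S) (SimpleGraph.mulCayley T) q) :
    (IsReducedCollection 𝔓 → IsReducedCollection 𝔔 →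
      (HypEmbedded 𝔓 S ↔ HypEmbedded 𝔔 T)) ∧
    ((∀ Q ∈ 𝔔, (Q : Set H).Infinite) → HypEmbedded 𝔔 T →
      ∀ 𝔓' : Set (Subgroup G), IsRefinement 𝔓 𝔓' → HypEmbedded 𝔓' S) := by
  obtain ⟨r, hc⟩ := exists_isCoarseInverse hS₀fin hS₀ hT₀fin hT₀ hT hpairs.1 hq
  have hm := hpairs.isCosetMatching hT₀fin hT₀
  refine ⟨fun hP hQ => ⟨fun h => ?_, fun h => ?_⟩, fun hinf h ℛ hR => ?_⟩
  · exact hc.symm.hypEmbedded hT hS (hc.isCosetMatching_symm hm) hQ.isCoarselySeparated h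
  · exact hc.hypEmbedded hS hT hm hP.isCoarselySeparated h
  · have hsep := h.isCoarselySeparated hT hinf
    exact hc.hypEmbedded hS hT (hc.isCosetMatching_of_isRefinement hm hsep hR h𝔓)
      (hc.isCoarselySeparated_of_isRefinement hm hsep hR) h
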